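/- Let $(X,\mathcal L,\lambda)$ be an arbitrary measure space, let $L_\infty(X,\mathcal L,\lambda)$ be the Banach space of (equivalence classes of) real-valued essentially bounded measurable functions on $X$ with the essential supremum norm $\|\cdot\|_\infty$, and let $(u_k)_{k\in\mathbb N}$ be a bounded sequence in $L_\infty(X,\mathcal L,\lambda)$. Then $u_k$ converges weakly to $0$ (that is, $f(u_k)\to 0$ for every bounded linear functional $f$ on $L_\infty(X,\mathcal L,\lambda)$) if and only if for every $\alpha>0$ and every strictly increasing sequence $(k_j)_{j\in\mathbb N}$ in $\mathbb N$ there exists $J\in\mathbb N$ such that $$\lambda\Big(\bigcap_{j\in\mathbb N,\ j\le J}\{x\in X: |u_{k_j}(x)|>\alpha\}\Big)=0 .$$ This criterion holds if and only if, for every strictly increasing sequence $(k_j)_{j\in\mathbb N}$ in $\mathbb N$, the functions $$v_J(x)=\min\{|u_{k_j}(x)| : j\in\mathbb N,\ j\le J\},\qquad x\in X,\ J\in\mathbb N,$$ satisfy $\|v_J\|_\infty\to 0$ as $J\to\infty$. -/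

import Mathlib

open MeasureTheory Filter Topology
open scoped ENNReal

/-- Weak convergence to zero in a real normed space `E`: convergence to zero in the weak topology
`σ(E, E*)`, where `E*` is the space of all bounded linear functionals on `E`. -/
def IsWeaklyNull {E : Type*} [NormedAddCommGroup E] [NormedSpace ℝ E] (u : ℕ → E) : Prop :=
  Tendsto (fun k => toWeakSpace ℝ E (u k)) atTop (𝓝 0)

/-- The set `A_α(u) = {x : |u x| > α}` for `u ∈ L_∞(X, μ)`
(determined by `u` up to a null set). -/
def superlevelSet {X : Type*} [MeasurableSpace X] {μ : Measure X} (α : ℝ) (u : Lp ℝ ∞ μ) :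
    Set X :=
  {x | α < |u x|}

/-- The pointwise minimum `x ↦ min_{j ≤ J} |w_j x|`. -/
noncomputable def pointwiseMin {X : Type*} [MeasurableSpace X] {μ : Measure X}
    (w : ℕ → Lp ℝ ∞ μ) (J : ℕ) (x : X) : ℝ :=
  (Finset.range (J + 1)).inf' Finset.nonempty_range_add_one (fun j => |w j x|)

theorem memLp_pointwiseMin {X : Type*} [MeasurableSpace X] {μ : Measure X}
    (w : ℕ → Lp ℝ ∞ μ) (J : ℕ) : MemLp (pointwiseMin w J) ∞ μ := by
  have hmeas : Measurable (pointwiseMin w J) := by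
    have h : Measurable ((Finset.range (J + 1)).inf' Finset.nonempty_range_add_one
        (fun j (x : X) => |w j x|)) :=
      Finset.inf'_induction _ _ (fun _ h₁ _ h₂ => h₁.inf h₂)
        (fun j _ => (Lp.stronglyMeasurable (w j)).measurable.abs)
    convert h using 1
    ext x
    simp [pointwiseMin, Finset.inf'_apply]
  refine (Lp.memLp (w 0)).mono hmeas.aestronglyMeasurable (Eventually.of_forall fun x => ?_)
  have h0 : 0 ≤ pointwiseMin w J x := Finset.le_inf' _ _ fun j _ => abs_nonneg _
  rw [Real.norm_of_nonneg h0, Real.norm_eq_abs]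
  exact Finset.inf'_le (fun j => |w j x|) (by simp)

/-- The pointwise minimum `v_J = min_{j ≤ J} |w_j|` as an element of `L_∞(X, μ)`. -/
noncomputable def runningMin {X : Type*} [MeasurableSpace X] {μ : Measure X}
    (w : ℕ → Lp ℝ ∞ μ) (J : ℕ) : Lp ℝ ∞ μ :=
  (memLp_pointwiseMin w J).toLp (pointwiseMin w J)

/-- For every `α > 0` and every strictly increasing `(k_j)` some finite intersection
`⋂_{j ≤ J} {|u_{k_j}| > α}` is a null set. -/
def NullIntersectionCriterion {X : Type*} [MeasurableSpace X] {μ : Measure X}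
    (u : ℕ → Lp ℝ ∞ μ) : Prop :=
  ∀ α : ℝ, 0 < α → ∀ k : ℕ → ℕ, StrictMono k →
    ∃ J : ℕ, μ (⋂ j ∈ Finset.range (J + 1), superlevelSet α (u (k j))) = 0

/-! Criterion to weak nullity: if `f (u k) ≥ ε` infinitely often, pass to that subsequence and
replace `f` by a positive `φ` with `φ |u k| ≥ s > 0` (`exists_positive_functional_le_abs`). The map
`x ↦ (|u k x|)_k` into the compact cube `[0, M]^ℕ` and Riesz representation turn `φ` into a finite
measure `ν` whose coordinate integrals are all at least `s`. By dominated convergence the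
coordinates fail to tend to zero on a set of positive `ν`-measure, and some `y` in it has only
non-null neighbourhoods. A subsequence of `y` exceeds some `α`, so `ν` charges the open set where
its first coordinates exceed `α`; the criterion makes the preimage null, a contradiction.
Conversely, if no finite intersection is null, an ultrafilter finer than `ae μ` contains them all,
and the limit along it is a functional violating weak nullity. -/

theorem isWeaklyNull_iff {E : Type*} [NormedAddCommGroup E] [NormedSpace ℝ E] (u : ℕ → E) :
    IsWeaklyNull u ↔ ∀ f : StrongDual ℝ E, Tendsto (fun k => f (u k)) atTop (𝓝 0) := by
  -- The weak topology is by definition the one induced by the pairing.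
  have hind : IsInducing (fun (x : WeakSpace ℝ E) (f : StrongDual ℝ E) =>
      (topDualPairing ℝ E).flip x f) := ⟨rfl⟩
  rw [IsWeaklyNull, hind.tendsto_nhds_iff, tendsto_pi_nhds]
  refine forall_congr' fun f => ?_
  have h0 : (topDualPairing ℝ E).flip (0 : WeakSpace ℝ E) f = 0 := map_zero f
  rw [h0]
  rfl

namespace MeasureTheory.Lp

variable {X : Type*} [MeasurableSpace X] {μ : Measure X}

theorem ae_abs_le_norm_top (f : Lp ℝ ∞ μ) : ∀ᵐ x ∂μ, |f x| ≤ ‖f‖ := by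
  filter_upwards [ae_le_eLpNormEssSup (f := f) (μ := μ)] with x hx
  rw [← Real.norm_eq_abs, ← toReal_enorm, Lp.norm_def, eLpNorm_exponent_top]
  refine ENNReal.toReal_mono ?_ hx
  rw [← eLpNorm_exponent_top]
  exact Lp.eLpNorm_ne_top f

theorem norm_top_le_of_ae_abs_le {f : Lp ℝ ∞ μ} {C : ℝ} (hC : 0 ≤ C)
    (h : ∀ᵐ x ∂μ, |f x| ≤ C) : ‖f‖ ≤ C := by
  rw [Lp.norm_def, eLpNorm_exponent_top]
  refine ENNReal.toReal_le_of_le_ofReal hC (eLpNormEssSup_le_of_ae_bound ?_)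
  simpa only [Real.norm_eq_abs] using h

theorem smul_le_smul_of_nonneg {f g : Lp ℝ ∞ μ} (h : f ≤ g) {t : ℝ} (ht : 0 ≤ t) :
    t • f ≤ t • g := by
  rw [← Lp.coeFn_le] at h ⊢
  filter_upwards [h, Lp.coeFn_smul t f, Lp.coeFn_smul t g] with x hx h1 h2
  rw [h1, h2]
  exact mul_le_mul_of_nonneg_left hx ht

instance instPosSMulMonoReal : PosSMulMono ℝ (Lp ℝ ∞ μ) :=
  ⟨fun _ ht _ _ h => smul_le_smul_of_nonneg h ht⟩

end MeasureTheory.Lp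

/-! ### Positive functionals: Hahn–Banach separation and Riesz representation. -/

open scoped Pointwise in
/-- If a bounded functional is bounded below by a positive constant on a set in a normed lattice,
some positive functional is bounded below by a positive constant on the absolute values. -/
theorem exists_positive_functional_le_abs {E : Type*} [NormedAddCommGroup E] [NormedSpace ℝ E]
    [Lattice E] [HasSolidNorm E] [IsOrderedAddMonoid E] [PosSMulMono ℝ E]
    (f : StrongDual ℝ E) {ε : ℝ} (hε : 0 < ε) :
    ∃ φ : StrongDual ℝ E, (∀ g, 0 ≤ g → 0 ≤ φ g) ∧
      ∃ s > 0, ∀ z : E, ε ≤ f z → s ≤ φ |z| := by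
  -- Chosen so that `‖z‖ < δ` forces `f z < ε`; the `+ 1` covers `f = 0`.
  set δ : ℝ := ε / (‖f‖ + 1) with hδ
  have hf1 : 0 < ‖f‖ + 1 := by positivity
  have hδ0 : 0 < δ := by positivity
  -- The ball makes `D` open, as separation needs; the negative cone bounds `φ` above on `Set.Iic
  -- 0`, which forces positivity.
  set D : Set E := Metric.ball 0 δ + Set.Iic 0
  set C : Set E := {c | ∃ z, |z| ≤ c ∧ ε ≤ f z}
  have hC : Convex ℝ C := by
    rintro a ⟨x, hxa, hx⟩ b ⟨y, hyb, hy⟩ p q hp hq hpq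
    refine ⟨p • x + q • y, abs_le'.2 ⟨?_, ?_⟩, ?_⟩
    · exact add_le_add (smul_le_smul_of_nonneg_left ((le_abs_self x).trans hxa) hp)
        (smul_le_smul_of_nonneg_left ((le_abs_self y).trans hyb) hq)
    · rw [neg_add, ← smul_neg, ← smul_neg]
      exact add_le_add (smul_le_smul_of_nonneg_left ((neg_le_abs x).trans hxa) hp)
        (smul_le_smul_of_nonneg_left ((neg_le_abs y).trans hyb) hq)
    · simp only [map_add, map_smul, smul_eq_mul]
      calc ε = p * ε + q * ε := by rw [← add_mul, hpq, one_mul]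
        _ ≤ _ := by gcongr
  have hdisj : Disjoint D C := by
    rw [Set.disjoint_left]
    rintro _ ⟨h, hh, n, hn, rfl⟩ ⟨z, hz, hfz⟩
    have hzh : |z| ≤ |h| := hz.trans <|
      (add_le_of_nonpos_right (Set.mem_Iic.1 hn)).trans (le_abs_self h)
    have h1 : ‖z‖ < δ := (norm_le_norm_of_abs_le_abs hzh).trans_lt (by simpa using hh)
    have h2 : f z ≤ ‖f‖ * ‖z‖ := (le_abs_self _).trans (f.le_opNorm z)
    have h3 : (‖f‖ + 1) * δ = ε := by rw [hδ]; field_simp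
    nlinarith [norm_nonneg z, norm_nonneg f]
  obtain ⟨φ, s, hD, hs⟩ := geometric_hahn_banach_open
    ((convex_ball (0 : E) δ).add (convex_Iic (𝕜 := ℝ) (0 : E))) Metric.isOpen_ball.add_right hC hdisj
  have hneg : ∀ n : E, n ≤ 0 → φ n < s := fun n hn =>
    hD n ⟨0, Metric.mem_ball_self hδ0, n, hn, zero_add n⟩
  have hs0 : 0 < s := by simpa using hneg 0 le_rfl
  refine ⟨φ, fun g hg => ?_, s, hs0, fun z hz => hs _ ⟨z, le_rfl, hz⟩⟩
  by_contra! hlt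
  -- Scaled so that `φ` takes exactly the forbidden value `s` at this negative element.
  have h1 := hneg (-((s / -φ g) • g))
    (neg_nonpos.2 (smul_nonneg (div_nonneg hs0.le (neg_pos.2 hlt).le) hg))
  rw [map_neg, map_smul, smul_eq_mul, ← mul_neg, div_mul_cancel₀ _ (neg_pos.2 hlt).ne'] at h1
  exact lt_irrefl _ h1

/-- A positive functional on `L_∞` pulled back along a measurable map into a compact space is
integration against a finite measure. -/
theorem exists_finite_measure_integral_eq {X : Type*} [MeasurableSpace X] {μ : Measure X}
    {K : Type*} [TopologicalSpace K] [CompactSpace K] [T2Space K] [MeasurableSpace K]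
    [BorelSpace K] {T : X → K} (hT : Measurable T) (φ : Lp ℝ ∞ μ →ₗ[ℝ] ℝ)
    (hφ : ∀ g, 0 ≤ g → 0 ≤ φ g) :
    ∃ ν : Measure K, IsFiniteMeasure ν ∧
      ∀ (g : C(K, ℝ)) (G : Lp ℝ ∞ μ), G =ᵐ[μ] g ∘ T → ∫ y, g y ∂ν = φ G := by
  have hmem : ∀ g : C(K, ℝ), MemLp (g ∘ T) ∞ μ := fun g =>
    memLp_top_of_bound (g.continuous.measurable.comp hT).aestronglyMeasurable ‖g‖
      (Eventually.of_forall fun x => g.norm_coe_le_norm (T x))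
  let S : CompactlySupportedContinuousMap K ℝ →ₗ[ℝ] Lp ℝ ∞ μ :=
    { toFun := fun g => (hmem g.toContinuousMap).toLp _
      map_add' := fun _ _ => rfl
      map_smul' := fun _ _ => rfl }
  let Λ : CompactlySupportedContinuousMap K ℝ →ₚ[ℝ] ℝ :=
    PositiveLinearMap.mk₀ (φ ∘ₗ S) fun g hg => hφ _ <| by
      rw [← Lp.coeFn_nonneg]
      filter_upwards [(hmem g.toContinuousMap).coeFn_toLp] with x hx
      exact (hg (T x)).trans_eq hx.symm
  refine ⟨RealRMK.rieszMeasure Λ, inferInstance, fun g G hG => ?_⟩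
  have h := RealRMK.integral_rieszMeasure Λ (CompactlySupportedContinuousMap.continuousMapEquiv g)
  refine h.trans (congrArg φ ?_)
  exact Lp.ext (((hmem g).coeFn_toLp).trans hG.symm)

/-! ### Consequences of the criterion. -/

namespace NullIntersectionCriterion

variable {X : Type*} [MeasurableSpace X] {μ : Measure X} {u : ℕ → Lp ℝ ∞ μ}

theorem comp_strictMono (h : NullIntersectionCriterion u) {k : ℕ → ℕ} (hk : StrictMono k) :
    NullIntersectionCriterion (u ∘ k) :=
  fun α hα j hj => h α hα (k ∘ j) (hk.comp hj)

/-- Under the criterion, a positive functional cannot stay bounded away from zero on the absolute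
values of a bounded sequence. -/
theorem not_forall_le_abs (h : NullIntersectionCriterion u) {M : ℝ} (hM : ∀ k, ‖u k‖ ≤ M)
    (φ : Lp ℝ ∞ μ →ₗ[ℝ] ℝ) (hφ : ∀ g, 0 ≤ g → 0 ≤ φ g) {s : ℝ} (hs : 0 < s) :
    ¬ ∀ k, s ≤ φ |u k| := by
  intro hle
  have hM0 : 0 ≤ M := (norm_nonneg _).trans (hM 0)
  -- The projection alters values only on a null set; it makes `T` land in the cube everywhere.
  let T : X → ℕ → Set.Icc (0 : ℝ) M := fun x k => Set.projIcc 0 M hM0 |u k x|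
  have hT : Measurable T := measurable_pi_lambda _ fun k =>
    (continuous_projIcc (h := hM0)).measurable.comp
      (Lp.stronglyMeasurable (u k)).measurable.abs
  have hTu : ∀ᵐ x ∂μ, ∀ k, (T x k : ℝ) = |u k x| := by
    refine ae_all_iff.2 fun k => ?_
    filter_upwards [Lp.ae_abs_le_norm_top (u k)] with x hx
    exact congrArg Subtype.val (Set.projIcc_of_mem hM0 ⟨abs_nonneg _, hx.trans (hM k)⟩)
  obtain ⟨ν, hν, hint⟩ := exists_finite_measure_integral_eq hT φ hφ
  have hcoord : ∀ k, s ≤ ∫ y : ℕ → Set.Icc (0 : ℝ) M, (y k : ℝ) ∂ν := fun k => by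
    refine (hle k).trans_eq (hint ⟨fun y => (y k : ℝ), by fun_prop⟩ |u k| ?_).symm
    filter_upwards [hTu, Lp.coeFn_abs (u k)] with x hx hx'
    exact hx'.trans (hx k).symm
  set N : Set (ℕ → Set.Icc (0 : ℝ) M) := {y | ¬ Tendsto (fun k => (y k : ℝ)) atTop (𝓝 0)}
  have hN : ν N ≠ 0 := by
    intro hN0
    have hlim := tendsto_integral_of_dominated_convergence (μ := ν)
      (F := fun k (y : ℕ → Set.Icc (0 : ℝ) M) => (y k : ℝ)) (f := fun _ => 0) (fun _ => M)
      (fun k => (by fun_prop : Measurable fun y : ℕ → Set.Icc (0 : ℝ) M =>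
        (y k : ℝ)).aestronglyMeasurable)
      (integrable_const M)
      (fun k => Eventually.of_forall fun y => by
        rw [Real.norm_of_nonneg (y k).2.1]; exact (y k).2.2)
      (by rw [ae_iff]; exact hN0)
    rw [integral_zero] at hlim
    exact hs.not_ge (ge_of_tendsto' hlim hcoord)
  obtain ⟨y, hyN, hy⟩ := exists_mem_forall_mem_nhdsWithin_pos_measure hN
  obtain ⟨α, hα, hfreq⟩ : ∃ α > 0, ∃ᶠ k in atTop, α < (y k : ℝ) := by
    by_contra! hcon
    refine hyN (Metric.tendsto_nhds.2 fun ε hε => ?_)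
    filter_upwards [hcon (ε / 2) (by positivity)] with k hk
    rw [Real.dist_eq, sub_zero, abs_of_nonneg (y k).2.1]
    linarith
  obtain ⟨k, hk, hky⟩ := extraction_of_frequently_atTop hfreq
  obtain ⟨J, hJ⟩ := h α hα k hk
  -- A continuous function that is positive exactly where the coordinates `k 0, …, k J` all exceed
  -- `α`, hence positive at `y`.
  let g : C(ℕ → Set.Icc (0 : ℝ) M, ℝ) :=
    ⟨fun z => max ((Finset.range (J + 1)).inf' Finset.nonempty_range_add_one
      (fun j => (z (k j) : ℝ)) - α) 0, by
      refine ((Continuous.finset_inf'_apply _ fun j _ => ?_).sub continuous_const).max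
        continuous_const
      fun_prop⟩
  have hg0 : ∀ z, 0 ≤ g z := fun z => le_max_right _ _
  have hgpos : ∀ z, 0 < g z ↔ ∀ j ∈ Finset.range (J + 1), α < (z (k j) : ℝ) := fun z => by
    simp [g]
  have hgint : ∫ z, g z ∂ν = 0 := by
    refine (hint g 0 ?_).trans (map_zero φ)
    filter_upwards [hTu, measure_eq_zero_iff_ae_notMem.1 hJ, Lp.coeFn_zero ℝ ∞ μ] with x hx hxJ h0
    rw [h0]
    refine le_antisymm (hg0 _) (not_lt.1 fun hlt => hxJ (Set.mem_iInter₂.2 fun j hj => ?_))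
    exact ((hgpos _).1 hlt j hj).trans_eq (hx _)
  have hU : 0 < ν (Function.support g) := by
    refine hy _ (mem_nhdsWithin_of_mem_nhds ?_)
    exact g.continuous.isOpen_support.mem_nhds ((hgpos y).2 fun j _ => hky j).ne'
  have hgi : Integrable g ν := Integrable.of_bound g.continuous.measurable.aestronglyMeasurable
    ‖g‖ (Eventually.of_forall g.norm_coe_le_norm)
  exact ((integral_pos_iff_support_of_nonneg hg0 hgi).2 hU).ne' hgint

theorem not_frequently_le (h : NullIntersectionCriterion u) {M : ℝ} (hM : ∀ k, ‖u k‖ ≤ M)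
    (f : StrongDual ℝ (Lp ℝ ∞ μ)) {ε : ℝ} (hε : 0 < ε) : ¬ ∃ᶠ k in atTop, ε ≤ f (u k) := by
  intro hfreq
  obtain ⟨k, hk, hkf⟩ := extraction_of_frequently_atTop hfreq
  obtain ⟨φ, hφ, s, hs, hφs⟩ := exists_positive_functional_le_abs f hε
  exact (h.comp_strictMono hk).not_forall_le_abs (fun j => hM (k j)) φ.toLinearMap hφ hs
    fun j => hφs _ (hkf j)

theorem isWeaklyNull (h : NullIntersectionCriterion u) {M : ℝ} (hM : ∀ k, ‖u k‖ ≤ M) :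
    IsWeaklyNull u := by
  refine (isWeaklyNull_iff u).2 fun f => Metric.tendsto_nhds.2 fun ε hε => ?_
  filter_upwards [not_frequently.1 (h.not_frequently_le hM f hε),
    not_frequently.1 (h.not_frequently_le hM (-f) hε)] with k h1 h2
  rw [Real.dist_eq, sub_zero, abs_lt]
  rw [neg_apply] at h2
  constructor <;> linarith

theorem tendsto_runningMin (h : NullIntersectionCriterion u) {k : ℕ → ℕ} (hk : StrictMono k) :
    Tendsto (fun J => runningMin (fun j => u (k j)) J) atTop (𝓝 0) := by
  refine Metric.tendsto_atTop.2 fun ε hε => ?_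
  -- Halved because the a.e. bound gives only a non-strict norm estimate.
  obtain ⟨J, hJ⟩ := h (ε / 2) (by positivity) k hk
  refine ⟨J, fun n hn => ?_⟩
  rw [dist_zero_right]
  refine (Lp.norm_top_le_of_ae_abs_le (half_pos hε).le ?_).trans_lt (half_lt_self hε)
  filter_upwards [measure_eq_zero_iff_ae_notMem.1 hJ,
    (memLp_pointwiseMin (fun j => u (k j)) n).coeFn_toLp] with x hx hxn
  have hnonneg : 0 ≤ pointwiseMin (fun j => u (k j)) n x :=
    Finset.le_inf' _ _ fun j _ => abs_nonneg _
  rw [runningMin, hxn, abs_of_nonneg hnonneg]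
  by_contra! hlt
  refine hx (Set.mem_iInter₂.2 fun j hj => hlt.trans_le (Finset.inf'_le (fun j => |u (k j) x|) ?_))
  rw [Finset.mem_range] at hj ⊢
  omega

end NullIntersectionCriterion

/-! ### Deriving the criterion. -/

section

variable {X : Type*} [MeasurableSpace X] {μ : Measure X}

theorem nullIntersectionCriterion_of_tendsto_runningMin {u : ℕ → Lp ℝ ∞ μ}
    (h : ∀ k : ℕ → ℕ, StrictMono k →
      Tendsto (fun J => runningMin (fun j => u (k j)) J) atTop (𝓝 0)) :
    NullIntersectionCriterion u := by
  intro α hα k hk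
  obtain ⟨J, hJ⟩ := Metric.tendsto_atTop.1 (h k hk) α hα
  refine ⟨J, measure_eq_zero_iff_ae_notMem.2 ?_⟩
  have hlt := hJ J le_rfl
  rw [dist_zero_right] at hlt
  filter_upwards [Lp.ae_abs_le_norm_top (runningMin (fun j => u (k j)) J),
    (memLp_pointwiseMin (fun j => u (k j)) J).coeFn_toLp] with x hx hxJ hmem
  rw [runningMin, hxJ] at hx
  refine ((le_abs_self _).trans hx).not_gt (hlt.trans ?_)
  exact (Finset.lt_inf'_iff _).2 fun j hj => Set.mem_iInter₂.1 hmem j hj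

theorem Ultrafilter.exists_tendsto_of_le_ae {F : Ultrafilter X} (hF : ↑F ≤ ae μ) (u : Lp ℝ ∞ μ) :
    ∃ a : ℝ, |a| ≤ ‖u‖ ∧ Tendsto u F (𝓝 a) := by
  have hle : ↑(F.map u) ≤ 𝓟 (Set.Icc (-‖u‖) ‖u‖) := by
    rw [le_principal_iff]
    exact ((Lp.ae_abs_le_norm_top u).filter_mono hF).mono fun x hx => abs_le.1 hx
  obtain ⟨a, ha, hlim⟩ := isCompact_Icc.ultrafilter_le_nhds (F.map u) hle
  exact ⟨a, abs_le.2 ha, hlim⟩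

/-- The limit along an ultrafilter finer than `ae μ` is a bounded functional on `L_∞`. -/
theorem Ultrafilter.exists_functional_of_le_ae {F : Ultrafilter X} (hF : ↑F ≤ ae μ) :
    ∃ f : StrongDual ℝ (Lp ℝ ∞ μ), ∀ u : Lp ℝ ∞ μ, Tendsto u F (𝓝 (f u)) := by
  choose L hbound hL using Ultrafilter.exists_tendsto_of_le_ae hF
  refine ⟨LinearMap.mkContinuous
    { toFun := L
      map_add' := fun u v => tendsto_nhds_unique (hL (u + v))
        (((hL u).add (hL v)).congr' ((Lp.coeFn_add u v).symm.filter_mono hF))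
      map_smul' := fun c u => tendsto_nhds_unique (hL (c • u))
        (((hL u).const_mul c).congr' ((Lp.coeFn_smul c u).symm.filter_mono hF)) }
    1 fun u => by simpa using hbound u, hL⟩

theorem IsWeaklyNull.nullIntersectionCriterion {u : ℕ → Lp ℝ ∞ μ} (h : IsWeaklyNull u) :
    NullIntersectionCriterion u := by
  intro α hα k hk
  by_contra! hpos
  set B : ℕ → Set X := fun J => ⋂ j ∈ Finset.range (J + 1), superlevelSet α (u (k j))
  have hB : Antitone B := fun I J hIJ => Set.biInter_subset_biInter_left fun j hj => by
    rw [Finset.coe_range, Set.mem_Iio] at hj ⊢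
    omega
  have : Nonempty X := (nonempty_of_measure_ne_zero (hpos 0)).to_type
  -- Each `B J` is non-null and they decrease, so together with `ae μ` they generate a proper
  -- filter.
  have hne : (⨅ J, ae μ ⊓ 𝓟 (B J)).NeBot := by
    refine iInf_neBot_of_directed (Antitone.directed_ge fun I J hIJ =>
      inf_le_inf_left _ (principal_mono.2 (hB hIJ))) fun J => ?_
    exact frequently_mem_iff_neBot.1 (frequently_ae_mem_iff.2 (hpos J))
  let F : Ultrafilter X := Ultrafilter.of (⨅ J, ae μ ⊓ 𝓟 (B J))
  have hFle : ∀ J, ↑F ≤ ae μ ⊓ 𝓟 (B J) := fun J => (Ultrafilter.of_le _).trans (iInf_le _ J)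
  obtain ⟨f, hf⟩ := Ultrafilter.exists_functional_of_le_ae ((hFle 0).trans inf_le_left)
  have hge : ∀ j, α ≤ |f (u (k j))| := fun j => by
    refine ge_of_tendsto (hf (u (k j))).abs ?_
    filter_upwards [le_principal_iff.1 ((hFle j).trans inf_le_right)] with x hx
    exact le_of_lt (Set.mem_iInter₂.1 hx j (Finset.self_mem_range_succ j))
  have hlim := (((isWeaklyNull_iff u).1 h f).comp hk.tendsto_atTop).abs
  rw [abs_zero] at hlim
  exact hα.not_ge (ge_of_tendsto' hlim hge)

end

theorem theorem3p5 {X : Type*} [MeasurableSpace X] (μ : Measure X) (u : ℕ → Lp ℝ ∞ μ)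
    (hu : ∃ M : ℝ, ∀ k, ‖u k‖ ≤ M) :
    (IsWeaklyNull u ↔ NullIntersectionCriterion u) ∧
    (NullIntersectionCriterion u ↔
      ∀ k : ℕ → ℕ, StrictMono k →
        Tendsto (fun J => runningMin (fun j => u (k j)) J) atTop (𝓝 0)) := by
  obtain ⟨M, hM⟩ := hu
  exact ⟨⟨fun h => h.nullIntersectionCriterion, fun h => h.isWeaklyNull hM⟩,
    fun h _ hk => h.tendsto_runningMin hk, nullIntersectionCriterion_of_tendsto_runningMin⟩
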